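/- Let $\mathbb F_2$ be the free group of rank two. For a group $\Gamma$ let $\Gamma^{(2)}$ be the (normal) subgroup generated by the squares of all elements of $\Gamma$. Put $\Gamma_0=\mathbb F_2$ and $\Gamma_n=\Gamma_{n-1}^{(2)}$ for $n\ge 1$; each $\Gamma_n$ is a normal subgroup of finite index in $\mathbb F_2$. Let $X_n$ be the vertex set of the Cayley graph of $\mathbb F_2/\Gamma_n$ with respect to the images of the two canonical generators, with its graph metric $d_{X_n}$. A metric $d$ on the disjoint union $X=\bigsqcup_{n\ge 0}X_n$ is called a *coarse union metric* if it restricts to $d_{X_n}$ on each $X_n$ and, for $n\neq m$, $d(X_n,X_m)\to\infty$ as $n+m\to\infty$. Let $d_X$ be the metric on $X$ with $d_X|_{X_n}=d_{X_n}$ and $d_X(x,y)=\operatorname{diam}(X_n)+\operatorname{diam}(X_m)+n+m$ for $x\in X_n$, $y\in X_m$, $n\ne m$. **Theorem.** The metric $d_X$ is a coarse union metric, and the box space $(X,d_X)$ is coarsely embeddable into a Hilbert space but does not have property A. The same two assertions hold for $(X,d)$ for every coarse union metric $d$ on $X$. Here a metric space $(X,d)$ is *coarsely embeddable into a Hilbert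 space* if there are a Hilbert space $\mathcal H$ and a map $f\colon X\to\mathcal H$ such that, for all sequences $(x_k)$, $(y_k)$ in $X$, $d(x_k,y_k)\to\infty$ if and only if $\|f(x_k)-f(y_k)\|\to\infty$. It has *property A* if for all $\varepsilon>0$ and $R>0$ there are finite subsets $A_x\subseteq X\times\mathbb N$ $(x\in X)$ and a number $S>0$ such that $A_x\cap A_y\neq\emptyset$ and $|A_x\mathbin{\triangle}A_y|/|A_x\cap A_y|<\varepsilon$ whenever $d(x,y)\le R$, and $A_x\subseteq B(x,S)\times\mathbb N$ for every $x\in X$, where $B(x,S)$ is the ball of radius $S$ around $x$. -/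

import Mathlib

open Filter

/-- For a subgroup `H` of a group, `H⁽²⁾`: the subgroup generated by the squares of all elements
of `H`. -/
def squareSubgroup {G : Type*} [Group G] (H : Subgroup G) : Subgroup G :=
  Subgroup.closure {x | ∃ h ∈ H, x = h ^ 2}

/-- The free group of rank two. -/
abbrev F₂ : Type := FreeGroup (Fin 2)

/-- `Γ₀ = F₂` and `Γₙ = (Γₙ₋₁)⁽²⁾`. -/
def Gam : ℕ → Subgroup F₂
  | 0 => ⊤
  | n + 1 => squareSubgroup (Gam n)

theorem squareSubgroup_le {G : Type*} [Group G] (H : Subgroup G) : squareSubgroup H ≤ H := by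
  refine (Subgroup.closure_le _).2 ?_
  rintro x ⟨h, hh, rfl⟩
  exact H.pow_mem hh 2

theorem squareSubgroup_normal {G : Type*} [Group G] (H : Subgroup G) [hH : H.Normal] :
    (squareSubgroup H).Normal := by
  constructor
  intro x hx g
  have key : squareSubgroup H ≤ (squareSubgroup H).comap (MulAut.conj g).toMonoidHom := by
    refine (Subgroup.closure_le _).2 ?_
    rintro y ⟨h, hh, rfl⟩
    refine Subgroup.subset_closure ⟨g * h * g⁻¹, hH.conj_mem h hh g, ?_⟩
    simp [pow_two, mul_assoc]
  simpa using key hx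

instance Gam_normal (n : ℕ) : (Gam n).Normal := by
  induction n with
  | zero => exact inferInstanceAs (⊤ : Subgroup F₂).Normal
  | succ n ih => exact squareSubgroup_normal (Gam n)

/-- A finitely generated group in which all squares are trivial is finite. -/
theorem finite_of_fg_of_sq_eq_one {Q : Type*} [Group Q] [Group.FG Q] (h : ∀ x : Q, x ^ 2 = 1) :
    Finite Q := by
  have hinv : ∀ x : Q, x⁻¹ = x := fun x => by
    rw [inv_eq_iff_mul_eq_one, ← pow_two, h]
  have hc : ∀ x y : Q, x * y = y * x := fun x y => by
    rw [← hinv (x * y), mul_inv_rev, hinv, hinv]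
  let _ : CommGroup Q := { (inferInstance : Group Q) with mul_comm := hc }
  refine CommGroup.finite_of_fg_isMulTorsion Q fun x => ?_
  exact isOfFinOrder_iff_pow_eq_one.2 ⟨2, by norm_num, h x⟩

theorem squareSubgroup_finiteIndex {G : Type*} [Group G] [Group.FG G] (H : Subgroup G)
    [hH : H.Normal] [H.FiniteIndex] : (squareSubgroup H).FiniteIndex := by
  have : (squareSubgroup H).Normal := squareSubgroup_normal H
  have hfin : Finite (H ⧸ (squareSubgroup H).subgroupOf H) := by
    refine finite_of_fg_of_sq_eq_one fun x => ?_
    induction x using QuotientGroup.induction_on with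
    | H x =>
      rw [← QuotientGroup.mk_pow, QuotientGroup.eq_one_iff, Subgroup.mem_subgroupOf]
      exact Subgroup.subset_closure ⟨x, x.2, by simp⟩
  constructor
  rw [← Subgroup.relIndex_mul_index (squareSubgroup_le H)]
  refine mul_ne_zero ?_ Subgroup.FiniteIndex.index_ne_zero
  exact Subgroup.index_ne_zero_of_finite (H := (squareSubgroup H).subgroupOf H)

instance Gam_finiteIndex (n : ℕ) : (Gam n).FiniteIndex := by
  induction n with
  | zero => exact inferInstanceAs (⊤ : Subgroup F₂).FiniteIndex
  | succ n ih => exact squareSubgroup_finiteIndex (Gam n)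

/-- The vertex set of the Cayley graph `Xₙ`: the finite group `F₂ ⧸ Γₙ`. -/
abbrev XPiece (n : ℕ) : Type := F₂ ⧸ Gam n

/-- The Cayley graph of `F₂ ⧸ Γₙ` with respect to the images of the canonical generators of `F₂`.
(Loops and multiple edges are discarded, which does not affect the graph metric.) -/
def XGraph (n : ℕ) : SimpleGraph (XPiece n) :=
  SimpleGraph.mulCayley (Set.range fun i : Fin 2 => (QuotientGroup.mk (FreeGroup.of i) : XPiece n))

theorem XGraph_connected (n : ℕ) : (XGraph n).Connected := by
  have step : ∀ (v : XPiece n) (i : Fin 2),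
      (XGraph n).Reachable v (v * (QuotientGroup.mk (FreeGroup.of i) : XPiece n)) := by
    intro v i
    by_cases h : v = v * (QuotientGroup.mk (FreeGroup.of i) : XPiece n)
    · rw [← h]
    · refine SimpleGraph.Adj.reachable ?_
      rw [XGraph, SimpleGraph.mulCayley_adj]
      exact ⟨h, Or.inl ⟨i, by simp⟩⟩
  have main : ∀ g : F₂, ∀ v : XPiece n,
      (XGraph n).Reachable v (v * (QuotientGroup.mk g : XPiece n)) := by
    intro g
    induction g using FreeGroup.induction_on with
    | C1 => intro v; simp
    | of i => exact fun v => step v i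
    | inv_of i _ =>
      intro v
      have := step (v * (QuotientGroup.mk (FreeGroup.of i)⁻¹ : XPiece n)) i
      simpa [mul_assoc] using this.symm
    | mul x y hx hy =>
      intro v
      have := (hx v).trans (hy _)
      simpa [mul_assoc] using this
  rw [SimpleGraph.connected_iff]
  refine ⟨fun u v => ?_, ⟨1⟩⟩
  obtain ⟨g, hg⟩ := QuotientGroup.mk_surjective (u⁻¹ * v)
  have := main g u
  rwa [hg, mul_inv_cancel_left] at this

/-- The graph metric on the vertex set of a connected graph: the length of a shortest path. -/
noncomputable abbrev SimpleGraph.Connected.metricSpace {V : Type*} {G : SimpleGraph V}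
    (hG : G.Connected) : MetricSpace V where
  dist u v := (G.dist u v : ℝ)
  dist_self u := by simp
  dist_comm u v := by rw [SimpleGraph.dist_comm]
  dist_triangle u v w := by exact_mod_cast hG.dist_triangle
  eq_of_dist_eq_zero {u v} h := hG.dist_eq_zero_iff.1 (by exact_mod_cast h)

/-- `Xₙ` carries its graph metric. -/
noncomputable instance XMetric (n : ℕ) : MetricSpace (XPiece n) := (XGraph_connected n).metricSpace

instance XBounded (n : ℕ) : BoundedSpace (XPiece n) :=
  ⟨(Set.toFinite (Set.univ : Set (XPiece n))).isBounded⟩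

/-- A metric on the disjoint union `⊔ Yₙ` of a sequence of metric spaces makes it a *coarse union*
of the `Yₙ` if it restricts to the given metric on each `Yₙ`, and the distance between `Yₙ` and
`Yₘ`, `n ≠ m`, tends to infinity as `n + m → ∞`. -/
structure IsCoarseUnion {Y : ℕ → Type*} [∀ n, MetricSpace (Y n)]
    (d : MetricSpace (Σ n, Y n)) : Prop where
  dist_same : ∀ (n : ℕ) (x y : Y n), d.dist ⟨n, x⟩ ⟨n, y⟩ = dist x y
  dist_ne : ∀ R : ℝ, ∃ N : ℕ, ∀ n m : ℕ, n ≠ m → N ≤ n + m →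
    ∀ (x : Y n) (y : Y m), R ≤ d.dist ⟨n, x⟩ ⟨m, y⟩

open Classical in
/-- The distance on `⊔ Yₙ` which is the given one on each `Yₙ`, and is
`diam Yₙ + diam Yₘ + n + m` between any point of `Yₙ` and any point of `Yₘ` for `n ≠ m`. -/
noncomputable def coarseUnionDist {Y : ℕ → Type*} [∀ n, MetricSpace (Y n)]
    (p q : Σ n, Y n) : ℝ :=
  if h : p.1 = q.1 then dist (h ▸ p.2) q.2
  else Metric.diam (Set.univ : Set (Y p.1)) + Metric.diam (Set.univ : Set (Y q.1)) + p.1 + q.1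

section
variable {Y : ℕ → Type*} [∀ n, MetricSpace (Y n)]

theorem coarseUnionDist_same (n : ℕ) (x y : Y n) :
    coarseUnionDist (⟨n, x⟩ : Σ n, Y n) ⟨n, y⟩ = dist x y := by
  simp [coarseUnionDist]

theorem coarseUnionDist_ne {n m : ℕ} (h : n ≠ m) (x : Y n) (y : Y m) :
    coarseUnionDist (⟨n, x⟩ : Σ n, Y n) ⟨m, y⟩ =
      Metric.diam (Set.univ : Set (Y n)) + Metric.diam (Set.univ : Set (Y m)) + n + m := by
  simp [coarseUnionDist, h]

/-- The coarse union metric with `d(Yₙ, Yₘ) = diam Yₙ + diam Yₘ + n + m` for `n ≠ m`. -/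
noncomputable abbrev coarseUnionMetric (Y : ℕ → Type*) [∀ n, MetricSpace (Y n)]
    [∀ n, BoundedSpace (Y n)] : MetricSpace (Σ n, Y n) where
  dist := coarseUnionDist
  dist_self := by
    rintro ⟨n, x⟩
    rw [coarseUnionDist_same, dist_self]
  dist_comm := by
    rintro ⟨n, x⟩ ⟨m, y⟩
    by_cases h : n = m
    · subst h
      rw [coarseUnionDist_same, coarseUnionDist_same, dist_comm]
    · rw [coarseUnionDist_ne h, coarseUnionDist_ne (Ne.symm h)]
      ring
  dist_triangle := by
    rintro ⟨n, x⟩ ⟨m, y⟩ ⟨k, z⟩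
    have hd : ∀ (j : ℕ) (a b : Y j), dist a b ≤ Metric.diam (Set.univ : Set (Y j)) :=
      fun j a b => Metric.dist_le_diam_of_mem (Bornology.isBounded_univ.2 inferInstance)
        (Set.mem_univ a) (Set.mem_univ b)
    have h0 : ∀ j : ℕ, 0 ≤ Metric.diam (Set.univ : Set (Y j)) := fun j => Metric.diam_nonneg
    have hn : (0 : ℝ) ≤ n := n.cast_nonneg
    have hm : (0 : ℝ) ≤ m := m.cast_nonneg
    have hk : (0 : ℝ) ≤ k := k.cast_nonneg
    by_cases h₁ : n = m
    · subst h₁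
      by_cases h₂ : n = k
      · subst h₂
        simp only [coarseUnionDist_same]
        exact dist_triangle x y z
      · rw [coarseUnionDist_same, coarseUnionDist_ne h₂, coarseUnionDist_ne h₂]
        linarith [dist_nonneg (x := x) (y := y)]
    · by_cases h₂ : m = k
      · subst h₂
        rw [coarseUnionDist_same, coarseUnionDist_ne h₁, coarseUnionDist_ne h₁]
        linarith [dist_nonneg (x := y) (y := z)]
      · rw [coarseUnionDist_ne h₁, coarseUnionDist_ne h₂]
        by_cases h₃ : n = k
        · subst h₃
          rw [coarseUnionDist_same]
          linarith [hd n x z, h0 n, h0 m]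
        · rw [coarseUnionDist_ne h₃]
          linarith [h0 m]
  eq_of_dist_eq_zero := by
    rintro ⟨n, x⟩ ⟨m, y⟩ h
    by_cases h₁ : n = m
    · subst h₁
      have h' : coarseUnionDist (⟨n, x⟩ : Σ n, Y n) ⟨n, y⟩ = 0 := h
      rw [coarseUnionDist_same] at h'
      rw [eq_of_dist_eq_zero h']
    · have h' : coarseUnionDist (⟨n, x⟩ : Σ n, Y n) ⟨m, y⟩ = 0 := h
      rw [coarseUnionDist_ne h₁] at h'
      have h0 : ∀ j : ℕ, 0 ≤ Metric.diam (Set.univ : Set (Y j)) := fun j => Metric.diam_nonneg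
      have hn : (0 : ℝ) ≤ n := n.cast_nonneg
      have hm : (0 : ℝ) ≤ m := m.cast_nonneg
      have en : (n : ℝ) = 0 := by linarith [h0 n, h0 m]
      have em : (m : ℝ) = 0 := by linarith [h0 n, h0 m]
      exact absurd (by exact_mod_cast en.trans em.symm) h₁

end

/-- The underlying set of the box space of `F₂` associated with the family `(Γₙ)`: the disjoint
union of the `Xₙ`. -/
abbrev BoxSpace : Type := Σ n, XPiece n

/-- The metric `d_X` of the box space: the graph metric on each `Xₙ`, and
`d_X(Xₙ, Xₘ) = diam Xₙ + diam Xₘ + n + m` for `n ≠ m`. -/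
noncomputable abbrev boxMetric : MetricSpace BoxSpace := coarseUnionMetric XPiece

/-- `X` is coarsely embeddable into a (real) Hilbert space: there are a Hilbert space `E` and a map
`f : X → E` with `dist (xₖ, yₖ) → ∞ ↔ ‖f xₖ - f yₖ‖ → ∞` for all sequences `xₖ`, `yₖ` in `X`. -/
def CoarselyEmbeddable {X : Type} (d : MetricSpace X) : Prop :=
  ∃ (E : Type) (_ : NormedAddCommGroup E) (_ : InnerProductSpace ℝ E) (_ : CompleteSpace E)
    (f : X → E), ∀ x y : ℕ → X,
      Tendsto (fun k => d.dist (x k) (y k)) atTop atTop ↔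
        Tendsto (fun k => ‖f (x k) - f (y k)‖) atTop atTop

open Classical in
/-- Property A: for all `ε, R > 0` there are finite sets `A x ⊆ X × ℕ` and `S > 0` with
`|A x ∆ A y| / |A x ∩ A y| < ε` (in particular `A x ∩ A y ≠ ∅`) whenever `d (x, y) ≤ R`, and
`A x ⊆ B(x, S) × ℕ` for every `x`. -/
def HasPropertyA {X : Type} (d : MetricSpace X) : Prop :=
  ∀ ε > (0 : ℝ), ∀ R > (0 : ℝ), ∃ (A : X → Finset (X × ℕ)) (S : ℝ), 0 < S ∧
    (∀ x y : X, d.dist x y ≤ R → (A x ∩ A y).Nonempty ∧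
      ((symmDiff (A x) (A y)).card : ℝ) / ((A x ∩ A y).card : ℝ) < ε) ∧
    ∀ x : X, ∀ p ∈ A x, d.dist p.1 x ≤ S

/-! Write `Q` for the quotient of the free group by the kernel of `φ`. Passing to the squares of the
kernel gives the `ℤ/2`-homology cover of the Cayley graph of `Q`: an element of the new quotient
amounts to an endpoint in `Q` together with the mod 2 chain of edges of a path from `1` to it.
Well-definedness is `pathChain_congr_mod`, injectivity is `mem_squareSubgroup_of_pathChain_eq`.

Embedding: send `x` in the piece `n + 1` to the indicator vector of its chain in the piece `n`. The
squared distance of two images counts the edges used an odd number of times by a path from `x` to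
`y`, so it is at most the distance. Conversely, a difference of at most `n` edges is below the girth
of the piece `n` and contains no cycle. Its boundary then forces it to be a single path, and the
word read along that path joins `x` to `y` (`GirthGT.exists_word`). The girth grows with `n` because
a closed path with zero mod 2 chain repeats an edge, hence contains a shorter closed path
(`GirthGT.squareSubgroup`). An extra coordinate `n ^ 2` separates the pieces.

Failure of property A: up to a fixed scale, a piece of large girth looks like the 4-regular tree.
Sort the points of `A x` by the first letter of the reduced word leading to them from `x`. Across
each edge, almost every common point lies ahead of one of its two ends, so the two corresponding
proportions add up to at least 2/3. There are two edges per vertex, but the proportions at a vertex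
sum to at most 1, and 4/3 > 1 (`false_of_directions`). -/

/-! ### Mod 2 chains of words and the squares of the kernel -/

section Words

variable {α Q : Type*} [Group Q] (φ : FreeGroup α →* Q)

/-- The edge of the Cayley graph (a pair of a source vertex and a generator) which a path traverses
when it reads the letter `l` at the vertex `q`. -/
def stepEdge (q : Q) (l : α × Bool) : Q × α :=
  if l.2 then (q, l.1) else (q * (φ (FreeGroup.of l.1))⁻¹, l.1)

/-- The list of edges traversed by the path that reads the word `L` from the vertex `q`. -/
def pathEdges : Q → List (α × Bool) → List (Q × α)
  | _, [] => []
  | q, l :: L => stepEdge φ q l :: pathEdges (q * φ (FreeGroup.mk [l])) L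

/-- The `ℤ/2`-chain of the path that reads the word `L` from the vertex `q`. -/
noncomputable def pathChain : Q → List (α × Bool) → (Q × α →₀ ZMod 2)
  | _, [] => 0
  | q, l :: L => Finsupp.single (stepEdge φ q l) 1 + pathChain (q * φ (FreeGroup.mk [l])) L

/-- The boundary of a `ℤ/2`-chain in the Cayley graph. -/
noncomputable def chainBoundary : (Q × α →₀ ZMod 2) →ₗ[ZMod 2] (Q →₀ ZMod 2) :=
  Finsupp.linearCombination (ZMod 2) fun e =>
    Finsupp.single e.1 1 + Finsupp.single (e.1 * φ (FreeGroup.of e.2)) 1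

theorem map_mk_cons (l : α × Bool) (L : List (α × Bool)) :
    φ (FreeGroup.mk (l :: L)) = φ (FreeGroup.mk [l]) * φ (FreeGroup.mk L) := by
  rw [← map_mul, FreeGroup.mul_mk]; rfl

theorem mk_singleton_true (i : α) : FreeGroup.mk [(i, true)] = FreeGroup.of i := rfl

theorem mk_singleton_false (i : α) : FreeGroup.mk [(i, false)] = (FreeGroup.of i)⁻¹ := rfl

theorem stepEdge_true (q : Q) (i : α) : stepEdge φ q (i, true) = (q, i) := rfl

theorem stepEdge_false (q : Q) (i : α) :
    stepEdge φ q (i, false) = (q * (φ (FreeGroup.of i))⁻¹, i) := rfl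

theorem stepEdge_snd (q : Q) (l : α × Bool) : (stepEdge φ q l).2 = l.1 := by
  unfold stepEdge; split <;> rfl

theorem length_pathEdges (q : Q) (L : List (α × Bool)) :
    (pathEdges φ q L).length = L.length := by
  induction L generalizing q with
  | nil => rfl
  | cons l L ih => simp [pathEdges, ih]

theorem add_self_chain {ι : Type*} (m : ι →₀ ZMod 2) : m + m = 0 := by
  ext e
  simpa using CharTwo.add_self_eq_zero (m e)

theorem pathChain_append (q : Q) (L₁ L₂ : List (α × Bool)) :
    pathChain φ q (L₁ ++ L₂) = pathChain φ q L₁ + pathChain φ (q * φ (FreeGroup.mk L₁)) L₂ := by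
  induction L₁ generalizing q with
  | nil => simp [pathChain, ← FreeGroup.one_eq_mk]
  | cons l L₁ ih =>
    rw [List.cons_append, pathChain, pathChain, ih, map_mk_cons φ l L₁, add_assoc, mul_assoc]

theorem chainBoundary_stepEdge (q : Q) (l : α × Bool) :
    chainBoundary φ (Finsupp.single (stepEdge φ q l) 1) =
      Finsupp.single q 1 + Finsupp.single (q * φ (FreeGroup.mk [l])) 1 := by
  obtain ⟨i, _ | _⟩ := l
  · rw [stepEdge_false, mk_singleton_false, map_inv]
    simp [chainBoundary, add_comm]
  · rw [stepEdge_true, mk_singleton_true]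
    simp [chainBoundary]

theorem chainBoundary_pathChain (q : Q) (L : List (α × Bool)) :
    chainBoundary φ (pathChain φ q L) =
      Finsupp.single q 1 + Finsupp.single (q * φ (FreeGroup.mk L)) 1 := by
  induction L generalizing q with
  | nil => simp [pathChain, ← FreeGroup.one_eq_mk, add_self_chain]
  | cons l L ih =>
    rw [pathChain, map_add, ih, chainBoundary_stepEdge, map_mk_cons φ l L, mul_assoc]
    set x := Finsupp.single (q * φ (FreeGroup.mk [l])) (1 : ZMod 2)
    rw [add_assoc, ← add_assoc x, add_self_chain, zero_add]

/-- A backtrack crosses the same edge twice, which cancels mod 2 and leaves the rest of the path in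
place. Hence the chain depends only on the group element and not on the word. -/
theorem pathChain_step {L₁ L₂ : List (α × Bool)} (h : FreeGroup.Red.Step L₁ L₂) (q : Q) :
    pathChain φ q L₁ = pathChain φ q L₂ := by
  obtain ⟨⟩ := h
  rename_i L₁ L₂ i b
  have hstep : ∀ q : Q, Finsupp.single (stepEdge φ q (i, b)) (1 : ZMod 2) +
      Finsupp.single (stepEdge φ (q * φ (FreeGroup.mk [(i, b)])) (i, !b)) 1 = 0 := by
    intro q
    cases b
    · rw [stepEdge_false, mk_singleton_false, map_inv, Bool.not_false, stepEdge_true,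
        add_self_chain]
    · rw [stepEdge_true, mk_singleton_true, Bool.not_true, stepEdge_false,
        mul_inv_cancel_right, add_self_chain]
  have hback : φ (FreeGroup.mk [(i, b)]) * φ (FreeGroup.mk [(i, !b)]) = 1 := by
    rw [← map_mul, FreeGroup.mul_mk]
    have : FreeGroup.mk ([(i, b)] ++ [(i, !b)]) = 1 :=
      Quot.sound (FreeGroup.Red.Step.not (L₁ := []) (L₂ := []))
    rw [this, map_one]
  rw [pathChain_append, pathChain_append, pathChain, pathChain, ← add_assoc (Finsupp.single _ _),
    hstep, zero_add, mul_assoc (_ * _), hback, mul_one]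

theorem pathChain_red {L₁ L₂ : List (α × Bool)} (h : FreeGroup.Red L₁ L₂) (q : Q) :
    pathChain φ q L₁ = pathChain φ q L₂ := by
  induction h with
  | refl => rfl
  | tail _ h ih => rw [ih, pathChain_step φ h]

theorem pathChain_congr {L₁ L₂ : List (α × Bool)} (h : FreeGroup.mk L₁ = FreeGroup.mk L₂) (q : Q) :
    pathChain φ q L₁ = pathChain φ q L₂ := by
  obtain ⟨L, h₁, h₂⟩ := FreeGroup.Red.exact.1 h
  rw [pathChain_red φ h₁, pathChain_red φ h₂]

theorem pathChain_mul [DecidableEq α] (q : Q) (g h : FreeGroup α) :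
    pathChain φ q (g * h).toWord = pathChain φ q g.toWord + pathChain φ (q * φ g) h.toWord := by
  rw [pathChain_congr φ (L₂ := g.toWord ++ h.toWord) _ q, pathChain_append, FreeGroup.mk_toWord]
  rw [← FreeGroup.mul_mk, FreeGroup.mk_toWord, FreeGroup.mk_toWord, FreeGroup.mk_toWord]

theorem squareSubgroup_ker_le : squareSubgroup φ.ker ≤ φ.ker := squareSubgroup_le _

/-- If `h` lies in the kernel its path is closed, so `h ^ 2` runs through the same loop twice and
every edge cancels. The base point stays arbitrary so that products can be handled by concatenation.
-/
theorem pathChain_eq_zero_of_mem [DecidableEq α] {g : FreeGroup α}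
    (hg : g ∈ squareSubgroup φ.ker) (q : Q) : pathChain φ q g.toWord = 0 := by
  induction hg using Subgroup.closure_induction generalizing q with
  | mem x hx =>
    obtain ⟨h, hh, rfl⟩ := hx
    rw [pow_two, pathChain_mul, MonoidHom.mem_ker.1 hh, mul_one, add_self_chain]
  | one => simp [pathChain]
  | mul x y hx hy ihx ihy => rw [pathChain_mul, ihx, ihy, add_zero]
  | inv x hx ih =>
    have hx' : φ x = 1 := squareSubgroup_ker_le φ hx
    have := pathChain_mul φ q x x⁻¹
    rw [mul_inv_cancel, ih, hx', mul_one, zero_add, FreeGroup.toWord_one, pathChain] at this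
    exact this.symm

theorem pathChain_congr_mod [DecidableEq α] {g h : FreeGroup α}
    (hg : g⁻¹ * h ∈ squareSubgroup φ.ker) (q : Q) :
    pathChain φ q g.toWord = pathChain φ q h.toWord := by
  rw [← mul_inv_cancel_left g h, pathChain_mul, pathChain_eq_zero_of_mem φ hg, add_zero]

/-- The mod 2 chain of a word determines its class modulo the squares of the elements of the
kernel. -/
theorem mem_squareSubgroup_of_pathChain_eq (hφ : Function.Surjective φ) (q : Q)
    {L₁ L₂ : List (α × Bool)} (hL : φ (FreeGroup.mk L₁) = φ (FreeGroup.mk L₂))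
    (hc : pathChain φ q L₁ = pathChain φ q L₂) :
    (FreeGroup.mk L₁)⁻¹ * FreeGroup.mk L₂ ∈ squareSubgroup φ.ker := by
  have hnormal : (squareSubgroup φ.ker).Normal := squareSubgroup_normal _
  have hsq : ∀ x : φ.ker ⧸ (squareSubgroup φ.ker).subgroupOf φ.ker, x ^ 2 = 1 := by
    intro x
    induction x using QuotientGroup.induction_on with
    | H x =>
      rw [← QuotientGroup.mk_pow, QuotientGroup.eq_one_iff, Subgroup.mem_subgroupOf]
      exact Subgroup.subset_closure ⟨x, x.2, by simp⟩
  have hinv : ∀ x : φ.ker ⧸ (squareSubgroup φ.ker).subgroupOf φ.ker, x⁻¹ = x := fun x => by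
    rw [inv_eq_iff_mul_eq_one, ← pow_two, hsq]
  let _ : CommGroup (φ.ker ⧸ (squareSubgroup φ.ker).subgroupOf φ.ker) :=
    { (inferInstance : Group (φ.ker ⧸ (squareSubgroup φ.ker).subgroupOf φ.ker)) with
      mul_comm := fun x y => by rw [← hinv (x * y), mul_inv_rev, hinv, hinv] }
  -- The kernel modulo its squares is an elementary abelian 2-group, so a linear map from chains
  -- into it can be specified edge by edge.
  let _ : Module (ZMod 2) (Additive (φ.ker ⧸ (squareSubgroup φ.ker).subgroupOf φ.ker)) :=
    AddCommGroup.zmodModule fun x => hsq x.toMul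
  obtain ⟨s, hs⟩ := hφ.hasRightInverse
  have hmem : ∀ (q : Q) (g : FreeGroup α), s q * g * (s (q * φ g))⁻¹ ∈ φ.ker := by
    intro q g
    simp [MonoidHom.mem_ker, hs _]
  -- The section `s` closes the path of `g` from `q` to a loop: `k` is the resulting cocycle, and
  -- its values on generators are the Schreier generators.
  let k : Q → FreeGroup α → φ.ker ⧸ (squareSubgroup φ.ker).subgroupOf φ.ker :=
    fun q g => QuotientGroup.mk ⟨s q * g * (s (q * φ g))⁻¹, hmem q g⟩
  have kmul : ∀ q g h, k q (g * h) = k q g * k (q * φ g) h := by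
    intro q g h
    simp only [k]
    rw [← QuotientGroup.mk_mul]
    congr 1
    ext
    simp [mul_assoc]
  -- Traversing an edge backwards gives the inverse class, which is the same class because all
  -- squares are trivial.
  have kinv : ∀ q g, k (q * (φ g)⁻¹) g = k q g⁻¹ := by
    intro q g
    have h1 := kmul q g⁻¹ g
    have h2 : k q 1 = 1 := by
      simp only [k]
      rw [QuotientGroup.eq_one_iff, Subgroup.mem_subgroupOf]
      simp
    rw [inv_mul_cancel, h2, map_inv] at h1
    rw [← hinv (k q g⁻¹), eq_comm, inv_eq_iff_mul_eq_one, ← h1]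
  let Φ := Finsupp.linearCombination (ZMod 2) fun e : Q × α =>
    Additive.ofMul (k e.1 (FreeGroup.of e.2))
  have hΦ : ∀ (L : List (α × Bool)) (q : Q),
      Φ (pathChain φ q L) = Additive.ofMul (k q (FreeGroup.mk L)) := by
    intro L
    induction L with
    | nil =>
      intro q
      rw [pathChain, map_zero]
      symm
      change k q 1 = 1
      simp only [k]
      rw [QuotientGroup.eq_one_iff, Subgroup.mem_subgroupOf]
      simp
    | cons l L ih =>
      intro q
      have : FreeGroup.mk (l :: L) = FreeGroup.mk [l] * FreeGroup.mk L := by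
        rw [FreeGroup.mul_mk]; rfl
      rw [pathChain, map_add, ih, this, kmul, ofMul_mul]
      congr 1
      obtain ⟨i, _ | _⟩ := l
      · rw [stepEdge_false, mk_singleton_false, ← kinv]
        simp [Φ]
      · rw [stepEdge_true, mk_singleton_true]
        simp [Φ]
  have h := hΦ L₁ q
  rw [hc, hΦ L₂ q] at h
  have h' : k q (FreeGroup.mk L₂) = k q (FreeGroup.mk L₁) := h
  simp only [k] at h'
  rw [eq_comm, QuotientGroup.eq, Subgroup.mem_subgroupOf] at h'
  -- Both values of `k` share the same outer factors from `s`; normality removes the one that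
  -- remains as a conjugation.
  have h'' := hnormal.conj_mem _ h' (s (q * φ (FreeGroup.mk L₁)))⁻¹
  simpa [mul_assoc, hL] using h''

end Words

/-! ### Girth, trails and short cycles -/

section Girth

variable {α Q : Type*} [Group Q] (φ : FreeGroup α →* Q)

/-- Every nonempty reduced word which represents an element of the kernel of `φ` has length greater
than `k`. -/
def GirthGT (k : ℕ) : Prop :=
  ∀ W : List (α × Bool), FreeGroup.IsReduced W → W ≠ [] → φ (FreeGroup.mk W) = 1 → k < W.length

theorem exists_of_mem_pathEdges {e : Q × α} {q : Q} {L : List (α × Bool)}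
    (he : e ∈ pathEdges φ q L) :
    ∃ L₁ l L₂, L = L₁ ++ l :: L₂ ∧ e = stepEdge φ (q * φ (FreeGroup.mk L₁)) l := by
  induction L generalizing q with
  | nil => simp [pathEdges] at he
  | cons l L ih =>
    rw [pathEdges, List.mem_cons] at he
    rcases he with rfl | he
    · exact ⟨[], l, L, rfl, by simp [← FreeGroup.one_eq_mk]⟩
    · obtain ⟨L₁, l', L₂, rfl, rfl⟩ := ih he
      exact ⟨l :: L₁, l', L₂, rfl, by rw [map_mk_cons φ l L₁, mul_assoc]⟩

/-- A reduced word whose path traverses an edge twice has a shorter nonempty reduced subword whose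
path is closed. -/
theorem exists_closed_of_not_nodup {q : Q} {L : List (α × Bool)} (hL : FreeGroup.IsReduced L)
    (h : ¬ (pathEdges φ q L).Nodup) :
    ∃ W : List (α × Bool), FreeGroup.IsReduced W ∧ W ≠ [] ∧ φ (FreeGroup.mk W) = 1 ∧
      W.length < L.length := by
  induction L generalizing q with
  | nil => simp [pathEdges] at h
  | cons l L ih =>
    rw [pathEdges, List.nodup_cons, not_and_or, not_not] at h
    rcases h with h | h
    · obtain ⟨L₁, l', L₂, rfl, he⟩ := exists_of_mem_pathEdges φ h
      have hl : l.1 = l'.1 := by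
        rw [← stepEdge_snd φ q l, he, stepEdge_snd]
      -- If the edge is traversed twice in the same direction, the path closes up between the two
      -- starts. If in opposite directions, the part strictly between the traversals is closed, and
      -- it is nonempty because a reduced word does not backtrack.
      by_cases hb : l.2 = l'.2
      · obtain rfl : l = l' := Prod.ext hl hb
        refine ⟨l :: L₁, hL.infix ⟨[], l :: L₂, by simp⟩, by simp, ?_, by simp⟩
        rw [map_mk_cons φ l L₁]
        obtain ⟨i, _ | _⟩ := l
        · simp only [stepEdge_false, Prod.mk.injEq, and_true, mul_assoc, mul_right_inj] at he
          rwa [← mul_assoc, right_eq_mul] at he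
        · simpa [stepEdge_true, mul_assoc] using he
      · refine ⟨L₁, hL.infix ⟨[l], l' :: L₂, by simp⟩, ?_, ?_, ?_⟩
        · rintro rfl
          rw [List.nil_append, FreeGroup.isReduced_cons_cons] at hL
          exact hb (hL.1 hl)
        · obtain ⟨i, b⟩ := l
          obtain ⟨j, b'⟩ := l'
          obtain rfl : i = j := hl
          cases b <;> cases b'
          · exact absurd rfl hb
          · simpa [stepEdge_true, stepEdge_false, mk_singleton_false, mul_assoc] using he
          · simp only [stepEdge_true, stepEdge_false, mk_singleton_true, Prod.mk.injEq, and_true,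
              mul_assoc, left_eq_mul] at he
            rwa [← mul_assoc, conj_eq_one_iff] at he
          · exact absurd rfl hb
        · simp only [List.length_cons, List.length_append]; omega
    · obtain ⟨W, h1, h2, h3, h4⟩ := ih (hL.infix ⟨[l], [], by simp⟩) h
      exact ⟨W, h1, h2, h3, h4.trans (by simp)⟩

theorem pathChain_apply_of_notMem {q : Q} {L : List (α × Bool)} {e : Q × α}
    (he : e ∉ pathEdges φ q L) : pathChain φ q L e = 0 := by
  induction L generalizing q with
  | nil => rfl
  | cons l L ih =>
    rw [pathEdges, List.mem_cons, not_or] at he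
    rw [pathChain, Finsupp.add_apply, ih he.2, Finsupp.single_eq_of_ne he.1, add_zero]

theorem pathChain_apply_of_nodup {q : Q} {L : List (α × Bool)} (h : (pathEdges φ q L).Nodup)
    {e : Q × α} (he : e ∈ pathEdges φ q L) : pathChain φ q L e = 1 := by
  induction L generalizing q with
  | nil => simp [pathEdges] at he
  | cons l L ih =>
    rw [pathEdges, List.nodup_cons] at h
    rw [pathEdges, List.mem_cons] at he
    rw [pathChain, Finsupp.add_apply]
    rcases he with rfl | he
    · rw [Finsupp.single_eq_same, pathChain_apply_of_notMem φ h.1, add_zero]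
    · rw [ih h.2 he, Finsupp.single_eq_of_ne (by rintro rfl; exact h.1 he), zero_add]

theorem card_support_pathChain_le (q : Q) (L : List (α × Bool)) :
    (pathChain φ q L).support.card ≤ L.length := by
  classical
  calc (pathChain φ q L).support.card ≤ (pathEdges φ q L).toFinset.card := by
        refine Finset.card_le_card fun e he => ?_
        rw [List.mem_toFinset]
        by_contra h
        exact Finsupp.mem_support_iff.1 he (pathChain_apply_of_notMem φ h)
    _ ≤ L.length := (List.toFinset_card_le _).trans (length_pathEdges φ q L).le

/-- Passing to the subgroup generated by the squares increases the girth. -/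
theorem GirthGT.squareSubgroup {k : ℕ} (h : GirthGT φ k) {W : List (α × Bool)}
    (hW : FreeGroup.IsReduced W) (hne : W ≠ [])
    (hmem : FreeGroup.mk W ∈ squareSubgroup φ.ker) : k + 1 < W.length := by
  classical
  have hzero : pathChain φ 1 W = 0 := by
    rw [← pathChain_eq_zero_of_mem φ hmem 1]
    exact pathChain_congr φ FreeGroup.mk_toWord.symm 1
  have hdup : ¬ (pathEdges φ 1 W).Nodup := by
    intro hd
    obtain ⟨l, L, rfl⟩ := List.exists_cons_of_ne_nil hne
    have := pathChain_apply_of_nodup φ hd (e := stepEdge φ 1 l) (by simp [pathEdges])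
    rw [hzero] at this
    exact zero_ne_one this
  obtain ⟨W', h1, h2, h3, h4⟩ := exists_closed_of_not_nodup φ hW hdup
  have := h W' h1 h2 h3
  omega

theorem zmod_two_eq_one {x : ZMod 2} (h : x ≠ 0) : x = 1 := by
  revert x; decide

/-- A cancelling pair of adjacent letters would traverse one edge twice. -/
theorem isReduced_of_nodup_pathEdges {q : Q} {L : List (α × Bool)}
    (h : (pathEdges φ q L).Nodup) : FreeGroup.IsReduced L := by
  induction L generalizing q with
  | nil => exact FreeGroup.IsReduced.nil
  | cons l L ih =>
    cases L with
    | nil => exact FreeGroup.IsReduced.singleton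
    | cons l' L =>
      rw [pathEdges] at h
      refine FreeGroup.isReduced_cons_cons.2 ⟨fun hl => ?_, ih h.of_cons⟩
      by_contra hb
      refine (List.nodup_cons.1 h).1 ?_
      rw [pathEdges]
      refine List.mem_cons.2 (Or.inl ?_)
      obtain ⟨i, b⟩ := l
      obtain ⟨j, b'⟩ := l'
      obtain rfl : i = j := hl
      cases b <;> cases b' <;>
        simp_all [stepEdge_true, stepEdge_false, mk_singleton_true, mk_singleton_false]

/-- A mod 2 chain with boundary `u + v` contains a trail from `u` to `v`. -/
theorem exists_trail (m : Q × α →₀ ZMod 2) (u v : Q)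
    (hm : chainBoundary φ m = Finsupp.single u 1 + Finsupp.single v 1) :
    ∃ L, u * φ (FreeGroup.mk L) = v ∧ (pathEdges φ u L).Nodup ∧
      ∀ e ∈ pathEdges φ u L, e ∈ m.support := by
  classical
  induction hk : m.support.card generalizing m u with
  | zero =>
    have hm0 : m = 0 := by simpa using hk
    refine ⟨[], ?_, by simp [pathEdges], by simp [pathEdges]⟩
    rw [hm0, map_zero] at hm
    by_contra hne
    have := DFunLike.congr_fun hm u
    rw [← FreeGroup.one_eq_mk, map_one, mul_one] at hne
    simp [Finsupp.single_eq_of_ne hne] at this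
  | succ k ih =>
    by_cases huv : u = v
    · exact ⟨[], by simp [huv, ← FreeGroup.one_eq_mk], by simp [pathEdges], by simp [pathEdges]⟩
    have hu : chainBoundary φ m u = 1 := by
      rw [hm]; simp [Finsupp.single_eq_of_ne huv]
    -- The boundary is odd at `u`, so some edge of `m` is incident to `u`. Removing it moves the
    -- starting point to its other end, which drives the induction on the number of edges.
    have hex : ∃ l, stepEdge φ u l ∈ m.support := by
      by_contra! hno
      rw [chainBoundary, Finsupp.linearCombination_apply, Finsupp.sum, Finsupp.finsetSum_apply,
        Finset.sum_eq_zero] at hu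
      · exact zero_ne_one hu
      · intro e he
        have h1 : u ≠ e.1 := by
          rintro rfl
          exact hno (e.2, true) he
        have h2 : u ≠ e.1 * φ (FreeGroup.of e.2) := by
          rintro rfl
          refine hno (e.2, false) ?_
          rwa [stepEdge_false, mul_inv_cancel_right]
        simp [Finsupp.single_eq_of_ne h1, Finsupp.single_eq_of_ne h2]
    obtain ⟨l, hl⟩ := hex
    have hsplit := Finsupp.erase_add_single (stepEdge φ u l) m
    rw [zmod_two_eq_one (Finsupp.mem_support_iff.1 hl)] at hsplit
    obtain ⟨L, h1, h2, h3⟩ := ih (m.erase (stepEdge φ u l)) (u * φ (FreeGroup.mk [l]))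
      (by
        rw [← hsplit, map_add, chainBoundary_stepEdge, ← add_assoc] at hm
        have hneg := neg_eq_of_add_eq_zero_left
          (add_self_chain (Finsupp.single (u * φ (FreeGroup.mk [l])) (1 : ZMod 2)))
        rw [add_comm (Finsupp.single (u * _) _), ← hneg, ← sub_eq_add_neg, eq_sub_iff_add_eq]
        refine add_right_cancel (b := Finsupp.single u 1) ?_
        rw [add_right_comm, hm, add_comm])
      (by rw [Finsupp.support_erase, Finset.card_erase_of_mem hl, hk]; rfl)
    refine ⟨l :: L, by rw [map_mk_cons φ l L, ← mul_assoc, h1], ?_, ?_⟩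
    · rw [pathEdges, List.nodup_cons]
      refine ⟨fun h => ?_, h2⟩
      simpa using h3 _ h
    · intro e he
      rw [pathEdges, List.mem_cons] at he
      rcases he with rfl | he
      · exact hl
      · have := h3 e he
        rw [Finsupp.support_erase] at this
        exact Finset.mem_of_mem_erase this

theorem length_le_card_of_nodup {u : Q} {L : List (α × Bool)} {s : Finset (Q × α)}
    (h : (pathEdges φ u L).Nodup) (hs : ∀ e ∈ pathEdges φ u L, e ∈ s) : L.length ≤ s.card := by
  classical
  rw [← length_pathEdges φ u L, ← List.toFinset_card_of_nodup h]
  exact Finset.card_le_card fun e he => hs e (List.mem_toFinset.1 he)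

/-- Below the girth there are no cycles. -/
theorem GirthGT.eq_zero_of_boundary {k : ℕ} (h : GirthGT φ k) (m : Q × α →₀ ZMod 2)
    (hm : m.support.card ≤ k) (hb : chainBoundary φ m = 0) : m = 0 := by
  classical
  by_contra hne
  obtain ⟨e, he⟩ := Finsupp.support_nonempty_iff.2 hne
  have hsplit := Finsupp.erase_add_single e m
  rw [zmod_two_eq_one (Finsupp.mem_support_iff.1 he)] at hsplit
  have hstep : stepEdge φ e.1 (e.2, true) = e := rfl
  -- Without `e`, the cycle has the same boundary as `e`, so it contains a trail from the head of
  -- `e` back to its tail. Closing it with `e` gives a reduced closed word of length at most `k`.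
  obtain ⟨L, h1, h2, h3⟩ := exists_trail φ (m.erase e) (e.1 * φ (FreeGroup.mk [(e.2, true)])) e.1
    (by
      rw [← hsplit, map_add] at hb
      conv at hb => enter [1, 2]; rw [← hstep, chainBoundary_stepEdge]
      rw [add_comm (Finsupp.single (e.1 * _) _)]
      have h' := add_self_chain (chainBoundary φ (m.erase e))
      exact add_left_cancel (h'.trans hb.symm))
  have hnd : (pathEdges φ e.1 ((e.2, true) :: L)).Nodup := by
    rw [pathEdges, List.nodup_cons, hstep]
    refine ⟨fun h => ?_, h2⟩
    simpa using h3 _ h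
  have hsub : ∀ e' ∈ pathEdges φ e.1 ((e.2, true) :: L), e' ∈ m.support := by
    intro e' he'
    rw [pathEdges, List.mem_cons, hstep] at he'
    rcases he' with rfl | he'
    · exact he
    · have := h3 e' he'
      rw [Finsupp.support_erase] at this
      exact Finset.mem_of_mem_erase this
  have hlen := length_le_card_of_nodup φ hnd hsub
  have := h _ (isReduced_of_nodup_pathEdges φ hnd) (by simp)
    (by rw [map_mk_cons φ _ L]; rw [mul_assoc] at h1; exact mul_eq_left.1 h1)
  omega

/-- A chain with boundary `u + v` that is smaller than the girth is a path from `u` to `v`. -/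
theorem GirthGT.exists_word {k : ℕ} (h : GirthGT φ k) (m : Q × α →₀ ZMod 2)
    (hm : m.support.card ≤ k) (u v : Q)
    (hb : chainBoundary φ m = Finsupp.single u 1 + Finsupp.single v 1) :
    ∃ L, u * φ (FreeGroup.mk L) = v ∧ pathChain φ u L = m ∧ L.length ≤ m.support.card := by
  classical
  obtain ⟨L, h1, h2, h3⟩ := exists_trail φ m u v hb
  refine ⟨L, h1, ?_, length_le_card_of_nodup φ h2 h3⟩
  have hsub : (pathChain φ u L + m).support ⊆ m.support := by
    intro e he
    by_cases heL : e ∈ pathEdges φ u L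
    · exact h3 e heL
    · rw [Finsupp.mem_support_iff, Finsupp.add_apply, pathChain_apply_of_notMem φ heL,
        zero_add] at he
      exact Finsupp.mem_support_iff.2 he
  -- The trail and `m` have the same boundary, so their sum is a cycle inside the support of `m`,
  -- too small to be nonzero.
  have hzero := h.eq_zero_of_boundary φ (pathChain φ u L + m)
    ((Finset.card_le_card hsub).trans hm)
    (by rw [map_add, chainBoundary_pathChain, hb, h1, add_self_chain])
  exact add_right_cancel (hzero.trans (add_self_chain m).symm)

end Girth

/-! ### Coarse embeddings of coarse unions -/

section CoarseUnions

theorem tendsto_atTop_of_control {X : Type*} {a b : X → X → ℝ}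
    (h : ∀ R : ℝ, ∃ S : ℝ, ∀ x y, a x y ≤ R → b x y ≤ S) {x y : ℕ → X}
    (hb : Tendsto (fun k => b (x k) (y k)) atTop atTop) :
    Tendsto (fun k => a (x k) (y k)) atTop atTop := by
  refine tendsto_atTop.2 fun R => ?_
  obtain ⟨S, hS⟩ := h R
  filter_upwards [tendsto_atTop.1 hb (S + 1)] with k hk
  by_contra hlt
  have := hS _ _ (not_le.1 hlt).le
  linarith

theorem coarselyEmbeddable_of_control {X E : Type} (d : MetricSpace X) [NormedAddCommGroup E]
    [InnerProductSpace ℝ E] [CompleteSpace E] (f : X → E)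
    (h₁ : ∀ R : ℝ, ∃ S : ℝ, ∀ x y, d.dist x y ≤ R → ‖f x - f y‖ ≤ S)
    (h₂ : ∀ R : ℝ, ∃ S : ℝ, ∀ x y, ‖f x - f y‖ ≤ R → d.dist x y ≤ S) : CoarselyEmbeddable d :=
  ⟨E, inferInstance, inferInstance, inferInstance, f, fun _ _ =>
    ⟨tendsto_atTop_of_control (a := fun x y => ‖f x - f y‖) (b := fun x y => d.dist x y) h₂,
      tendsto_atTop_of_control (a := fun x y => d.dist x y) (b := fun x y => ‖f x - f y‖) h₁⟩⟩

theorem exists_bound_initial_pieces {Y : ℕ → Type*} [∀ n, Finite (Y n)]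
    (g : (Σ n, Y n) → (Σ n, Y n) → ℝ) (N : ℕ) :
    ∃ S : ℝ, ∀ p q : Σ n, Y n, p.1 < N → q.1 < N → g p q ≤ S := by
  have hfin : {p : Σ n, Y n | p.1 < N}.Finite := by
    refine ((Set.finite_Iio N).biUnion fun n _ => Set.finite_range (Sigma.mk n)).subset ?_
    rintro ⟨n, x⟩ hn
    exact Set.mem_biUnion (x := n) hn ⟨x, rfl⟩
  obtain ⟨S, hS⟩ := ((hfin.prod hfin).image fun pq => g pq.1 pq.2).bddAbove
  exact ⟨S, fun p q hp hq => hS ⟨(p, q), ⟨hp, hq⟩, rfl⟩⟩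

/-- The reason for the coordinate `n ^ 2`: bounded differences of squares leave only finitely many
pairs of distinct indices. -/
theorem add_le_abs_sq_sub_sq {n m : ℕ} (h : n ≠ m) :
    (n + m : ℝ) ≤ |(n : ℝ) ^ 2 - (m : ℝ) ^ 2| := by
  have h1 : (1 : ℝ) ≤ |(n : ℝ) - m| := by
    have : (1 : ℤ) ≤ |(n : ℤ) - m| := Int.one_le_abs (sub_ne_zero.2 (by exact_mod_cast h))
    exact_mod_cast this
  rw [sq_sub_sq, abs_mul, abs_of_nonneg (by positivity : (0 : ℝ) ≤ n + m)]
  exact le_mul_of_one_le_right (by positivity) h1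

/-- A coarse union of finite metric spaces is coarsely embeddable if the pieces have maps to a
Hilbert space which are uniformly Lipschitz for the square root of the metric, and expanding on
scales that grow with the piece. -/
theorem IsCoarseUnion.coarselyEmbeddable {Y : ℕ → Type} [∀ n, MetricSpace (Y n)]
    [∀ n, Finite (Y n)] {H : Type} [NormedAddCommGroup H] [InnerProductSpace ℝ H] [CompleteSpace H]
    (ψ : ∀ n, Y n → H) (hup : ∀ n x y, ‖ψ n x - ψ n y‖ ^ 2 ≤ dist x y)
    (hlow : ∀ n x y, ‖ψ n x - ψ n y‖ ^ 2 < n → dist x y ≤ ‖ψ n x - ψ n y‖ ^ 2)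
    {d : MetricSpace (Σ n, Y n)} (hd : IsCoarseUnion d) : CoarselyEmbeddable d := by
  let f : (Σ n, Y n) → WithLp 2 (H × ℝ) := fun p => WithLp.toLp 2 (ψ p.1 p.2, (p.1 : ℝ) ^ 2)
  have hf : ∀ p q, ‖f p - f q‖ ^ 2 =
      ‖ψ p.1 p.2 - ψ q.1 q.2‖ ^ 2 + ((p.1 : ℝ) ^ 2 - (q.1 : ℝ) ^ 2) ^ 2 := by
    intro p q
    rw [WithLp.prod_norm_sq_eq_of_L2]
    simp [f]
  refine coarselyEmbeddable_of_control d f (fun R => ?_) fun R => ?_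
  · obtain ⟨N, hN⟩ := hd.dist_ne (R + 1)
    obtain ⟨S, hS⟩ := exists_bound_initial_pieces (fun p q => ‖f p - f q‖) N
    refine ⟨max S (R + 1), ?_⟩
    rintro ⟨n, x⟩ ⟨m, y⟩ hxy
    by_cases hnm : n = m
    · subst hnm
      rw [hd.dist_same] at hxy
      have h1 := hf ⟨n, x⟩ ⟨n, y⟩
      have h2 := hup n x y
      simp only [sub_self] at h1
      refine le_max_of_le_right ?_
      -- With `t` the norm, `(t - 1) ^ 2 ≥ 0` turns `t ^ 2 ≤ R` into `2 * t ≤ R + 1`.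
      nlinarith [sq_nonneg (‖f ⟨n, x⟩ - f ⟨n, y⟩‖ - 1)]
    · refine le_max_of_le_left ?_
      have hlt : n + m < N := by
        by_contra hge
        have := hN n m hnm (not_lt.1 hge) x y
        linarith
      exact hS ⟨n, x⟩ ⟨m, y⟩ (by dsimp only; omega) (by dsimp only; omega)
  -- The bound `R ^ 2 < N` makes `hlow` applicable in every piece of index at least `N`; the bound
  -- `R < N` confines pairs in distinct pieces to the initial ones.
  · obtain ⟨N, hN⟩ := exists_nat_gt (max R (R ^ 2))
    obtain ⟨S, hS⟩ := exists_bound_initial_pieces (fun p q => d.dist p q) N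
    refine ⟨max S (R ^ 2), ?_⟩
    rintro ⟨n, x⟩ ⟨m, y⟩ hxy
    have hsq : ‖f ⟨n, x⟩ - f ⟨m, y⟩‖ ^ 2 ≤ R ^ 2 := pow_le_pow_left₀ (norm_nonneg _) hxy 2
    rw [hf] at hsq
    by_cases hnm : n = m
    · subst hnm
      simp only [sub_self] at hsq
      by_cases hn : n < N
      · exact le_max_of_le_left (hS _ _ hn hn)
      · refine le_max_of_le_right ?_
        rw [hd.dist_same]
        have hn' : (N : ℝ) ≤ n := by exact_mod_cast not_lt.1 hn
        have h1 : R ^ 2 < N := (le_max_right _ _).trans_lt hN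
        have h2 := hlow n x y (by linarith)
        linarith
    · have hR : |(n : ℝ) ^ 2 - (m : ℝ) ^ 2| ≤ R := by
        refine abs_le_of_sq_le_sq ?_ ((norm_nonneg _).trans hxy)
        have := sq_nonneg ‖ψ n x - ψ m y‖
        dsimp only at hsq
        linarith
      have hlt : n + m < N := by
        have h' : (n + m : ℝ) < N :=
          ((add_le_abs_sq_sub_sq hnm).trans hR).trans_lt ((le_max_left R (R ^ 2)).trans_lt hN)
        exact_mod_cast h'
      exact le_max_of_le_left (hS _ _ (by dsimp only; omega) (by dsimp only; omega))

theorem isCoarseUnion_coarseUnionMetric (Y : ℕ → Type*) [∀ n, MetricSpace (Y n)]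
    [∀ n, BoundedSpace (Y n)] : IsCoarseUnion (coarseUnionMetric Y) where
  dist_same := coarseUnionDist_same
  dist_ne R := by
    obtain ⟨N, hN⟩ := exists_nat_ge R
    refine ⟨N, fun n m hnm hle x y => ?_⟩
    change R ≤ coarseUnionDist _ _
    rw [coarseUnionDist_ne hnm]
    have h0 : ∀ j : ℕ, 0 ≤ Metric.diam (Set.univ : Set (Y j)) := fun j => Metric.diam_nonneg
    have : (N : ℝ) ≤ n + m := by exact_mod_cast hle
    linarith [h0 n, h0 m]

end CoarseUnions

/-! ### The Cayley graphs of the quotients: girth and word metric -/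

section Pieces

theorem mem_Gam_succ_iff (n : ℕ) (g : F₂) :
    g ∈ Gam (n + 1) ↔ g ∈ squareSubgroup (QuotientGroup.mk' (Gam n)).ker := by
  rw [QuotientGroup.ker_mk', Gam]

theorem girthGT_Gam (n : ℕ) : GirthGT (QuotientGroup.mk' (Gam n)) n := by
  induction n with
  | zero => exact fun W _ hne _ => List.length_pos_of_ne_nil hne
  | succ n ih =>
    intro W hW hne hmem
    refine ih.squareSubgroup _ hW hne ?_
    rw [← mem_Gam_succ_iff]
    exact (QuotientGroup.eq_one_iff _).1 hmem

theorem XPiece_dist_eq {n : ℕ} (x y : XPiece n) : dist x y = ((XGraph n).dist x y : ℝ) := rfl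

theorem XPiece_dist_mul_of_le (n : ℕ) (x : XPiece n) (i : Fin 2) :
    dist x (x * (QuotientGroup.mk' (Gam n) (FreeGroup.of i))) ≤ 1 := by
  by_cases h : x = x * (QuotientGroup.mk' (Gam n) (FreeGroup.of i))
  · rw [← h, dist_self]; exact zero_le_one
  · have hadj : (XGraph n).Adj x (x * (QuotientGroup.mk' (Gam n) (FreeGroup.of i))) := by
      rw [XGraph, SimpleGraph.mulCayley_adj]
      exact ⟨h, Or.inl ⟨i, by simp⟩⟩
    rw [XPiece_dist_eq, SimpleGraph.dist_eq_one_iff_adj.2 hadj, Nat.cast_one]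

theorem XPiece_dist_mul_letter_le (n : ℕ) (x : XPiece n) (l : Fin 2 × Bool) :
    dist x (x * (QuotientGroup.mk' (Gam n) (FreeGroup.mk [l]))) ≤ 1 := by
  obtain ⟨i, _ | _⟩ := l
  · rw [mk_singleton_false, map_inv, dist_comm]
    have := XPiece_dist_mul_of_le n (x * (QuotientGroup.mk' (Gam n) (FreeGroup.of i))⁻¹) i
    rwa [inv_mul_cancel_right] at this
  · exact XPiece_dist_mul_of_le n x i

theorem XPiece_dist_mul_mk_le {n : ℕ} (x : XPiece n) (L : List (Fin 2 × Bool)) :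
    dist x (x * QuotientGroup.mk' (Gam n) (FreeGroup.mk L)) ≤ L.length := by
  induction L generalizing x with
  | nil => rw [← FreeGroup.one_eq_mk, map_one, mul_one, dist_self]; simp
  | cons l L ih =>
    rw [map_mk_cons _ l L, ← mul_assoc, List.length_cons, Nat.cast_add, Nat.cast_one, add_comm]
    exact (dist_triangle _ _ _).trans (add_le_add (XPiece_dist_mul_letter_le n x l) (ih _))

theorem XGraph_walk_exists_word {n : ℕ} {x y : XPiece n} (p : (XGraph n).Walk x y) :
    ∃ L : List (Fin 2 × Bool), x * QuotientGroup.mk' (Gam n) (FreeGroup.mk L) = y ∧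
      L.length = p.length := by
  induction p with
  | nil => exact ⟨[], by rw [← FreeGroup.one_eq_mk, map_one, mul_one], rfl⟩
  | @cons u v w h p ih =>
    obtain ⟨L, hL, hlen⟩ := ih
    have hl : ∃ l : Fin 2 × Bool, u * QuotientGroup.mk' (Gam n) (FreeGroup.mk [l]) = v := by
      rw [XGraph, SimpleGraph.mulCayley_adj'] at h
      obtain ⟨-, g, ⟨i, rfl⟩, h | h⟩ := h
      · exact ⟨(i, true), h⟩
      · refine ⟨(i, false), ?_⟩
        rw [h, mk_singleton_false, map_inv]
        exact mul_inv_cancel_right _ _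
    obtain ⟨l, hl⟩ := hl
    exact ⟨l :: L, by rw [map_mk_cons _ l L, ← mul_assoc, hl, hL], by simp [hlen]⟩

theorem XPiece_exists_word {n : ℕ} (x y : XPiece n) :
    ∃ L : List (Fin 2 × Bool), x * QuotientGroup.mk' (Gam n) (FreeGroup.mk L) = y ∧
      (L.length : ℝ) = dist x y := by
  obtain ⟨p, hp⟩ := (XGraph_connected n).exists_walk_length_eq_dist x y
  obtain ⟨L, hL, hlen⟩ := XGraph_walk_exists_word p
  exact ⟨L, hL, by rw [XPiece_dist_eq, hlen, hp]⟩

theorem XPiece_exists_reduced_word {n : ℕ} (x y : XPiece n) :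
    ∃ L : List (Fin 2 × Bool), FreeGroup.IsReduced L ∧
      x * QuotientGroup.mk' (Gam n) (FreeGroup.mk L) = y ∧ (L.length : ℝ) ≤ dist x y := by
  obtain ⟨L, hL, hlen⟩ := XPiece_exists_word x y
  refine ⟨(FreeGroup.mk L).toWord, FreeGroup.isReduced_toWord, by rwa [FreeGroup.mk_toWord], ?_⟩
  rw [← hlen]
  exact_mod_cast FreeGroup.norm_mk_le

end Pieces

/-! ### The Hilbert space embedding by mod 2 chains -/

section Embedding

noncomputable instance XPiece_fintype (n : ℕ) : Fintype (XPiece n) := Fintype.ofFinite _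

/-- The real indicator vector of a mod 2 chain. -/
noncomputable def chainVector {ι : Type*} (m : ι →₀ ZMod 2) : EuclideanSpace ℝ ι :=
  WithLp.toLp 2 fun e => ((m e).val : ℝ)

theorem norm_chainVector_sub_sq {ι : Type*} [Fintype ι] (m m' : ι →₀ ZMod 2) :
    ‖chainVector m - chainVector m'‖ ^ 2 = ((m + m').support.card : ℝ) := by
  classical
  have h : ∀ a b : ZMod 2, ((a.val : ℝ) - b.val) ^ 2 = if a + b ≠ 0 then 1 else 0 := by
    intro a b
    fin_cases a <;> fin_cases b <;> simp [ZMod.val] <;> decide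
  have hs : (m + m').support = Finset.univ.filter fun e => m e + m' e ≠ 0 := by
    ext e; simp
  rw [EuclideanSpace.real_norm_sq_eq, hs, Finset.card_filter]
  push_cast
  refine Finset.sum_congr rfl fun e _ => ?_
  rw [← h]
  rfl

/-- The chain, in the Cayley graph of `F₂ ⧸ Γₙ`, of a path that starts at `1` and represents a
given element of `F₂ ⧸ Γₙ₊₁`. -/
noncomputable def pieceChain (n : ℕ) (x : XPiece (n + 1)) : XPiece n × Fin 2 →₀ ZMod 2 :=
  pathChain (QuotientGroup.mk' (Gam n)) 1 x.out.toWord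

/-- The path to `y` may be taken through `x`; the common initial part cancels mod 2 and a path from
`x` to `y` remains. -/
theorem pieceChain_add (n : ℕ) (x y : XPiece (n + 1)) :
    pieceChain n x + pieceChain n y =
      pathChain (QuotientGroup.mk' (Gam n)) (QuotientGroup.mk' (Gam n) x.out)
        (x.out⁻¹ * y.out).toWord := by
  have h := pathChain_mul (QuotientGroup.mk' (Gam n)) 1 x.out (x.out⁻¹ * y.out)
  rw [mul_inv_cancel_left, one_mul] at h
  rw [pieceChain, pieceChain, h, ← add_assoc, add_self_chain, zero_add]

/-- The difference chain can be computed from a geodesic word, which crosses at most as many edges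
as it has letters. -/
theorem card_support_pieceChain_add_le (n : ℕ) (x y : XPiece (n + 1)) :
    ((pieceChain n x + pieceChain n y).support.card : ℝ) ≤ dist x y := by
  obtain ⟨L, hL, hlen⟩ := XPiece_exists_word x y
  have hmem : (x.out⁻¹ * y.out)⁻¹ * FreeGroup.mk L ∈
      squareSubgroup (QuotientGroup.mk' (Gam n)).ker := by
    rw [← mem_Gam_succ_iff, ← QuotientGroup.eq, QuotientGroup.mk_mul, QuotientGroup.mk_inv,
      QuotientGroup.out_eq', QuotientGroup.out_eq', inv_mul_eq_iff_eq_mul]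
    exact hL.symm
  rw [pieceChain_add, pathChain_congr_mod _ hmem, pathChain_congr _ FreeGroup.mk_toWord, ← hlen]
  exact Nat.cast_le.2 (card_support_pathChain_le (QuotientGroup.mk' (Gam n)) _ L)

/-- Below the girth the difference chain is the chain of a short word `L`. Since chain and endpoint
determine the class modulo the next subgroup, `L` itself leads from `x` to `y` in the cover. -/
theorem dist_le_card_support_pieceChain_add (n : ℕ) (x y : XPiece (n + 1))
    (h : (pieceChain n x + pieceChain n y).support.card ≤ n) :
    dist x y ≤ ((pieceChain n x + pieceChain n y).support.card : ℝ) := by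
  obtain ⟨L, h1, h2, h3⟩ := (girthGT_Gam n).exists_word _ (pieceChain n x + pieceChain n y) h
    (QuotientGroup.mk' (Gam n) x.out) (QuotientGroup.mk' (Gam n) y.out)
    (by
      rw [pieceChain_add, chainBoundary_pathChain, FreeGroup.mk_toWord, ← map_mul,
        mul_inv_cancel_left])
  rw [pieceChain_add] at h2
  have hmem := mem_squareSubgroup_of_pathChain_eq _ (QuotientGroup.mk'_surjective _) _
    (L₁ := L) (L₂ := (x.out⁻¹ * y.out).toWord)
    (by
      rw [FreeGroup.mk_toWord, map_mul, map_inv, ← h1, inv_mul_cancel_left]) h2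
  rw [← mem_Gam_succ_iff, FreeGroup.mk_toWord, ← QuotientGroup.eq, QuotientGroup.mk_mul,
    QuotientGroup.mk_inv, QuotientGroup.out_eq', QuotientGroup.out_eq', eq_inv_mul_iff_mul_eq]
    at hmem
  have h4 : dist x y ≤ L.length := by
    have := XPiece_dist_mul_mk_le x L
    rwa [QuotientGroup.mk'_apply, hmem] at this
  exact h4.trans (by exact_mod_cast h3)

/-- The map of the piece `F₂ ⧸ Γₙ₊₁` to a Hilbert space given by the mod 2 chains of paths in the
Cayley graph of `F₂ ⧸ Γₙ`. -/
noncomputable def pieceEmbedding :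
    ∀ n, XPiece n → lp (fun n : ℕ => EuclideanSpace ℝ (XPiece n × Fin 2)) 2
  | 0, _ => 0
  | n + 1, x => lp.single 2 n (chainVector (pieceChain n x))

theorem norm_pieceEmbedding_sub_sq (n : ℕ) (x y : XPiece (n + 1)) :
    ‖pieceEmbedding (n + 1) x - pieceEmbedding (n + 1) y‖ ^ 2 =
      ((pieceChain n x + pieceChain n y).support.card : ℝ) := by
  rw [pieceEmbedding, pieceEmbedding, ← lp.single_sub, lp.norm_single (by norm_num),
    norm_chainVector_sub_sq]

theorem IsCoarseUnion.coarselyEmbeddable_box {d : MetricSpace BoxSpace} (hd : IsCoarseUnion d) :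
    CoarselyEmbeddable d := by
  refine hd.coarselyEmbeddable pieceEmbedding (fun n x y => ?_) fun n x y h => ?_
  · cases n with
    | zero => simp [pieceEmbedding]
    | succ n =>
      rw [norm_pieceEmbedding_sub_sq]
      exact card_support_pieceChain_add_le n x y
  · cases n with
    | zero => simp [pieceEmbedding] at h
    | succ n =>
      rw [norm_pieceEmbedding_sub_sq] at h ⊢
      -- The piece of index `n + 1` is embedded through the graph of index `n`, so the hypothesis `<
      -- n + 1` is exactly `≤ n`.
      exact dist_le_card_support_pieceChain_add n x y (Nat.lt_succ_iff.1 (by exact_mod_cast h))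

end Embedding

/-! ### Failure of property A -/

section PropertyA

/-- Each of `A` and `B` has at most 3/2 times as many elements as `A ∩ B`, so passing from
proportions in the intersection to proportions in `A` or `B` costs at most a factor 2/3. -/
theorem two_thirds_le_add {T : Type*} [DecidableEq T] {A B : Finset T} (hne : (A ∩ B).Nonempty)
    (hlt : ((symmDiff A B).card : ℝ) / ((A ∩ B).card : ℝ) < 1 / 2) {D D' : T → Prop}
    [DecidablePred D] [DecidablePred D'] (hD : ∀ t ∈ A ∩ B, D t ∨ D' t) :
    (2 / 3 : ℝ) ≤ ((A.filter D).card : ℝ) / A.card + ((B.filter D').card : ℝ) / B.card := by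
  have hI : (0 : ℝ) < (A ∩ B).card := by exact_mod_cast hne.card_pos
  rw [div_lt_iff₀ hI] at hlt
  have bound : ∀ C : Finset T, A ∩ B ⊆ C → C \ (A ∩ B) ⊆ symmDiff A B →
      ∀ E : T → Prop, ∀ _ : DecidablePred E,
      (2 / 3 : ℝ) * (((A ∩ B).filter E).card / (A ∩ B).card) ≤ ((C.filter E).card : ℝ) / C.card := by
    intro C hC hC' E _
    have h1 : (((A ∩ B).filter E).card : ℝ) ≤ (C.filter E).card := by
      exact_mod_cast Finset.card_le_card (Finset.filter_subset_filter E hC)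
    have h2 : (C.card : ℝ) ≤ 3 / 2 * (A ∩ B).card := by
      have h3 : (C.card : ℝ) = (C \ (A ∩ B)).card + (A ∩ B).card := by
        exact_mod_cast (Finset.card_sdiff_add_card_eq_card hC).symm
      have h4 : ((C \ (A ∩ B)).card : ℝ) ≤ (symmDiff A B).card := by
        exact_mod_cast Finset.card_le_card hC'
      linarith
    have h5 : (0 : ℝ) < C.card := by
      exact_mod_cast (hne.mono hC).card_pos
    rw [← mul_div_assoc, div_le_div_iff₀ hI h5]
    have h6 : (0 : ℝ) ≤ ((A ∩ B).filter E).card := by positivity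
    nlinarith
  have hA := bound A Finset.inter_subset_left
    (by intro t; simp only [Finset.mem_sdiff, Finset.mem_inter, Finset.mem_symmDiff]; tauto)
    D inferInstance
  have hB := bound B Finset.inter_subset_right
    (by intro t; simp only [Finset.mem_sdiff, Finset.mem_inter, Finset.mem_symmDiff]; tauto)
    D' inferInstance
  have hcover : ((A ∩ B).card : ℝ) ≤ ((A ∩ B).filter D).card + ((A ∩ B).filter D').card := by
    have : A ∩ B ⊆ (A ∩ B).filter D ∪ (A ∩ B).filter D' := by
      intro t ht
      rw [← Finset.filter_or]
      exact Finset.mem_filter.2 ⟨ht, hD t ht⟩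
    exact_mod_cast (Finset.card_le_card this).trans (Finset.card_union_le _ _)
  have hone : (1 : ℝ) ≤ (((A ∩ B).filter D).card : ℝ) / (A ∩ B).card +
      (((A ∩ B).filter D').card : ℝ) / (A ∩ B).card := by
    rw [← add_div, le_div_iff₀ hI, one_mul]
    exact hcover
  linarith

/-- A counting obstruction to property A: on a finite group with two marked elements, almost
invariant finite sets cannot be split along the four directions of the Cayley graph. -/
theorem false_of_directions {Q T : Type*} [Group Q] [Fintype Q] [DecidableEq T] (g : Fin 2 → Q)
    (A : Q → Finset T) (D : Q → Fin 2 × Bool → T → Prop)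
    (hdisj : ∀ x l l' t, D x l t → D x l' t → l = l')
    (hcover : ∀ x i, ∀ t ∈ A x ∩ A (x * g i), D x (i, true) t ∨ D (x * g i) (i, false) t)
    (hA : ∀ x i, (A x ∩ A (x * g i)).Nonempty ∧
      ((symmDiff (A x) (A (x * g i))).card : ℝ) / ((A x ∩ A (x * g i)).card : ℝ) < 1 / 2) :
    False := by
  classical
  let w : Q → Fin 2 × Bool → ℝ := fun x l => (((A x).filter (D x l)).card : ℝ) / (A x).card
  have hsum : ∀ x, ∑ l, w x l ≤ 1 := by
    intro x
    simp only [w]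
    rw [← Finset.sum_div]
    refine div_le_one_of_le₀ ?_ (by positivity)
    rw [← Nat.cast_sum, ← Finset.card_biUnion]
    · exact_mod_cast Finset.card_le_card
        (Finset.biUnion_subset.2 fun l _ => Finset.filter_subset _ _)
    · intro l _ l' _ hll'
      rw [Function.onFun, Finset.disjoint_left]
      intro t ht ht'
      exact hll' (hdisj x l l' t (Finset.mem_filter.1 ht).2 (Finset.mem_filter.1 ht').2)
  have hpair : ∀ x i, 2 / 3 ≤ w x (i, true) + w (x * g i) (i, false) := fun x i =>
    two_thirds_le_add (hA x i).1 (hA x i).2 (hcover x i)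
  have hi : ∀ i, (Fintype.card Q : ℝ) * (2 / 3) ≤ ∑ x, (w x (i, true) + w x (i, false)) := by
    intro i
    calc (Fintype.card Q : ℝ) * (2 / 3) = ∑ _x : Q, (2 / 3 : ℝ) := by simp
      _ ≤ ∑ x, (w x (i, true) + w (x * g i) (i, false)) := Finset.sum_le_sum fun x _ => hpair x i
      _ = ∑ x, (w x (i, true) + w x (i, false)) := by
        rw [Finset.sum_add_distrib, Finset.sum_add_distrib]
        congr 1
        -- Right translation permutes the finite group, so the weight seen from the far end of each
        -- edge can be charged to its own vertex.
        exact Equiv.sum_comp (Equiv.mulRight (g i)) fun x => w x (i, false)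
  have htotal : ∑ x, ∑ l, w x l ≤ Fintype.card Q := by
    calc ∑ x, ∑ l, w x l ≤ ∑ _x : Q, (1 : ℝ) := Finset.sum_le_sum fun x _ => hsum x
      _ = Fintype.card Q := by simp
  have hsplit : ∑ x, ∑ l, w x l = ∑ i, ∑ x, (w x (i, true) + w x (i, false)) := by
    rw [Finset.sum_comm (s := (Finset.univ : Finset (Fin 2)))]
    refine Finset.sum_congr rfl fun x _ => ?_
    rw [Fintype.sum_prod_type]
    simp
  rw [hsplit, Fin.sum_univ_two] at htotal
  have hpos : (0 : ℝ) < Fintype.card Q := by exact_mod_cast Fintype.card_pos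
  linarith [hi 0, hi 1]

/-- Below half the girth, reduced words are determined by their value in the quotient. -/
theorem GirthGT.eq_of_map_eq {α Q : Type*} [Group Q] {φ : FreeGroup α →* Q} {k : ℕ}
    (h : GirthGT φ k) {L L' : List (α × Bool)} (hL : FreeGroup.IsReduced L)
    (hL' : FreeGroup.IsReduced L') (hlen : L.length + L'.length ≤ k)
    (heq : φ (FreeGroup.mk L) = φ (FreeGroup.mk L')) : L = L' := by
  classical
  have h1 : FreeGroup.mk L = FreeGroup.mk L' := by
    by_contra hne
    have hnorm := h ((FreeGroup.mk L)⁻¹ * FreeGroup.mk L').toWord FreeGroup.isReduced_toWord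
      (by rwa [Ne, FreeGroup.toWord_eq_nil_iff, inv_mul_eq_one])
      (by rw [FreeGroup.mk_toWord, map_mul, map_inv, heq, inv_mul_cancel])
    have h2 := FreeGroup.norm_mul_le (FreeGroup.mk L)⁻¹ (FreeGroup.mk L')
    rw [FreeGroup.norm_inv_eq] at h2
    have h3 := FreeGroup.norm_mk_le (L₁ := L)
    have h4 := FreeGroup.norm_mk_le (L₁ := L')
    unfold FreeGroup.norm at *
    omega
  have := FreeGroup.reduce.sound h1
  rwa [hL.reduce_eq, hL'.reduce_eq] at this

theorem IsCoarseUnion.not_hasPropertyA_box {d : MetricSpace BoxSpace} (hd : IsCoarseUnion d) :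
    ¬ HasPropertyA d := by
  classical
  intro hA
  obtain ⟨A, S', -, hclose, hball⟩ := hA (1 / 2) (by norm_num) 1 one_pos
  obtain ⟨S, hS⟩ := exists_nat_ge S'
  obtain ⟨N, hN⟩ := hd.dist_ne (S + 1)
  -- Beyond `N`, no other piece comes within distance `S` of the piece `n`. The bound `2 * S + 2`
  -- makes two reduced words of length at most `S + 1` with the same value equal.
  let n := max N (2 * S + 2)
  have hn : 2 * S + 2 ≤ n := le_max_right _ _
  let φ := QuotientGroup.mk' (Gam n)
  refine false_of_directions (Q := XPiece n) (fun i => φ (FreeGroup.of i)) (fun x => A ⟨n, x⟩)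
    (fun x l t => ∃ L, FreeGroup.IsReduced L ∧ L.length ≤ S + 1 ∧ L.head? = some l ∧
      t.1 = ⟨n, x * φ (FreeGroup.mk L)⟩) ?_ ?_ ?_
  · rintro x l l' t ⟨L, h1, h2, h3, h4⟩ ⟨L', h1', h2', h3', h4'⟩
    rw [h4, Sigma.mk.injEq, heq_eq_eq, mul_right_inj] at h4'
    obtain rfl := (girthGT_Gam n).eq_of_map_eq h1 h1' (by omega) h4'.2
    exact Option.some_injective _ (h3.symm.trans h3')
  · intro x i t ht
    have hdist := (hball _ t (Finset.mem_inter.1 ht).1).trans hS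
    obtain ⟨⟨m, z⟩, j⟩ := t
    have hmn : m = n := by
      by_contra hne
      have := hN m n hne (by omega) z x
      dsimp only at hdist
      linarith
    subst hmn
    dsimp only at hdist
    rw [hd.dist_same, dist_comm] at hdist
    obtain ⟨L, h1, h2, h3⟩ := XPiece_exists_reduced_word x z
    have hlen : L.length ≤ S := by exact_mod_cast h3.trans hdist
    -- If the reduced word from `x` does not begin with the edge towards the neighbour, prefixing
    -- the inverse letter gives a reduced word from the neighbour. This extra letter is why lengths
    -- up to `S + 1` are allowed.
    by_cases hhead : L.head? = some (i, true)
    · exact Or.inl ⟨L, h1, by omega, hhead, by rw [← h2]⟩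
    · refine Or.inr ⟨(i, false) :: L, ?_, by simpa using hlen, rfl, ?_⟩
      · cases L with
        | nil => exact FreeGroup.IsReduced.singleton
        | cons l L =>
          refine FreeGroup.isReduced_cons_cons.2 ⟨fun hi => ?_, h1⟩
          by_contra hb
          refine hhead ?_
          obtain ⟨i', b⟩ := l
          obtain rfl : i = i' := hi
          cases b
          · exact absurd rfl hb
          · rfl
      · rw [map_mk_cons φ _ L, mk_singleton_false, map_inv, mul_assoc, mul_inv_cancel_left, ← h2]
  · intro x i
    convert hclose ⟨n, x⟩ ⟨n, x * φ (FreeGroup.of i)⟩ (by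
      rw [hd.dist_same]; exact XPiece_dist_mul_of_le n x i)

end PropertyA

/-- `d_X` is a coarse union metric on `X = ⊔ Xₙ`, and for `d_X` as well as for every other such
metric, `X` is coarsely embeddable into a Hilbert space but does not have property A. -/
theorem theorem1p2 :
    IsCoarseUnion boxMetric ∧
      (CoarselyEmbeddable boxMetric ∧ ¬ HasPropertyA boxMetric) ∧
      ∀ d : MetricSpace BoxSpace, IsCoarseUnion d →
        CoarselyEmbeddable d ∧ ¬ HasPropertyA d :=
  have hbox : IsCoarseUnion boxMetric := isCoarseUnion_coarseUnionMetric XPiece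
  ⟨hbox, ⟨hbox.coarselyEmbeddable_box, hbox.not_hasPropertyA_box⟩,
    fun _ hd => ⟨hd.coarselyEmbeddable_box, hd.not_hasPropertyA_box⟩⟩
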